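/- Let $n\ge 2$, $1\le s\le k$ and $1\le p\le\lambda$ be integers, and index the coordinates of $\mathbb R^{n^k}$ by $i=(i_1,\dots,i_k)\in S^k$, where $|S|=n$. For $\mathbf x\in\mathbb R^{n^k}$ and $u\subseteq[k]=\{1,\dots,k\}$ define recursively $$x_u(i)=n^{-k+|u|}\sum_{i'\,:\,i'_j=i_j\ \forall j\in u}x(i')-\sum_{v\subsetneq u}x_v(i),\qquad J^{\mathbf x}_u(i)=n^k\,x_u(i)$$ (the $J$-characteristics of $\mathbf x$). Let $F$ be the set of integer vectors $\mathbf x$ with $0\le x(i)\le p$ for all $i$ such that for every $u\subseteq[k]$ with $|u|=s$ and every $i$ the sum of $x(i')$ over all $i'$ agreeing with $i$ on $u$ equals $\lambda$ (for $p=\lambda$ these are exactly the frequency vectors of the orthogonal arrays $\mathrm{OA}(\lambda n^s,k,n,s)$). Let $P=P^{(k,s,\lambda)}_{n;I}$ be the convex hull of $F$. Let $F_J$ be the set of integer vectors $\mathbf x$ with $0\le x(i)\le p$ that satisfy the equality constraints $$(\ast)\qquad J^{\mathbf x}_\emptyset(i)=\lambda n^s,\qquad J^{\mathbf x}_u(i)=0\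 \text{ for } 1\le|u|\le s,\qquad\text{for all } i.$$ Assume that $F_J\neq\emptyset$. Then the following hold. (a) Let $\Omega=\{d\in\{1,\dots,k-s\}: \lambda\binom{s+d-1}{d-1}\equiv0\pmod n\}$. There is some $T\subseteq\Omega$ such that $$\dim P=n^k-\sum_{j=0}^s\binom kj(n-1)^j-\sum_{d\in T}\binom k{s+d}(n-1)^{s+d},$$ and the equalities $(\ast)$ together with the equalities $J^{\mathbf x}_u(i)=0$ for all $i$ and all $u\subseteq[k]$ with $|u|=s+d$ for some $d\in T$ define the affine hull of $F_J$, and likewise the affine hull of $F$. (b) Suppose that $n=2$ and $s$ is even, and let $\Omega'=\{d \text{ even}: 0\le d\le k-s-1,\ \lambda\binom{s+d}{d}\equiv0\pmod 2\}$. There is some $T\subseteq\Omega'$ such that $$\dim P=2^k-\sum_{j=0}^s\binom kj-\sum_{d\in T}\left(\binom k{s+d+1}+\binom k{s+d+2}\right),$$ where $\binom km=0$ for $m>k$, and the equalities $(\ast)$ together with the equalities $J^{\mathbf x}_u(i)=0$ for all $i$ and all $u\subseteq[k]$ with $|u|\in\{s+d+1,s+d+2\}$ for some $d\in T$ define the affine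 hull of $F_J$, and likewise the affine hull of $F$. -/

import Mathlib

/-- The number of rows (summed frequency) of `x` that agree with `i` on the columns in `u`:
the sum of `x i'` over all `i'` with `i' j = i j` for `j ∈ u`. -/
noncomputable def marginalSum {k n : ℕ} (x : (Fin k → Fin n) → ℝ) (u : Finset (Fin k))
    (i : Fin k → Fin n) : ℝ :=
  ∑ i' : Fin k → Fin n with ∀ j ∈ u, i' j = i j, x i'

/-- The ANOVA interaction `x_u`, defined recursively by
`x_u(i) = n^(-k+|u|) * ∑_{i_j, j ∉ u} x(i) - ∑_{v ⊊ u} x_v(i)`. -/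
noncomputable def anova {k n : ℕ} (x : (Fin k → Fin n) → ℝ) (u : Finset (Fin k))
    (i : Fin k → Fin n) : ℝ :=
  (n : ℝ) ^ (-(k : ℤ) + (u.card : ℤ)) * marginalSum x u i
    - ∑ v : {v : Finset (Fin k) // v ∈ u.ssubsets}, anova x v.1 i
termination_by u.card
decreasing_by exact Finset.card_lt_card (Finset.mem_ssubsets.mp v.2)

/-- The `J`-characteristic `J_u^x(i) = n^k * x_u(i)`. -/
noncomputable def jChar {k n : ℕ} (x : (Fin k → Fin n) → ℝ) (u : Finset (Fin k))
    (i : Fin k → Fin n) : ℝ :=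
  (n : ℝ) ^ k * anova x u i

/-- The bound and integrality constraints `0 ≤ x(i) ≤ p`, `x(i) ∈ ℤ`. -/
def IntegralBox {k n : ℕ} (p : ℕ) (x : (Fin k → Fin n) → ℝ) : Prop :=
  ∀ i, 0 ≤ x i ∧ x i ≤ (p : ℝ) ∧ ∃ z : ℤ, x i = (z : ℝ)

/-- The marginal equality constraints: every `s`-tuple of symbols occurs `l` times in every
set of `s` columns. -/
def MarginalEqs {k n : ℕ} (s l : ℕ) (x : (Fin k → Fin n) → ℝ) : Prop :=
  ∀ u : Finset (Fin k), u.card = s → ∀ i, marginalSum x u i = (l : ℝ)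

/-- The same equality constraints through `J`-characteristics. -/
def JEqs {k n : ℕ} (s l : ℕ) (x : (Fin k → Fin n) → ℝ) : Prop :=
  (∀ i, jChar x ∅ i = (l : ℝ) * (n : ℝ) ^ s) ∧
    ∀ u : Finset (Fin k), 1 ≤ u.card → u.card ≤ s → ∀ i, jChar x u i = 0

/-- Feasible points of the integer linear description given by marginals. -/
def feasible (k n s l p : ℕ) : Set ((Fin k → Fin n) → ℝ) :=
  {x | MarginalEqs s l x ∧ IntegralBox p x}

/-- Feasible points of the integer linear description given by `J`-characteristics. -/
def feasibleJ (k n s l p : ℕ) : Set ((Fin k → Fin n) → ℝ) :=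
  {x | JEqs s l x ∧ IntegralBox p x}

/-- The `(k, s, l)` orthogonal array polytope. -/
def oaPolytope (k n s l p : ℕ) : Set ((Fin k → Fin n) → ℝ) :=
  convexHull ℝ (feasible k n s l p)

/-- The dimension of a nonempty convex set: the dimension of its affine hull. -/
noncomputable def convDim {V : Type*} [AddCommGroup V] [Module ℝ V] (P : Set V) : ℕ :=
  Module.finrank ℝ (affineSpan ℝ P).direction

/-- `{d ∈ {1, …, k - s} | l * C(s + d - 1, d - 1) ≡ 0 (mod n)}`. -/
def omegaSet (k n s l : ℕ) : Finset ℕ :=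
  {d ∈ Finset.Icc 1 (k - s) | n ∣ l * (s + d - 1).choose (d - 1)}

/-- `{d even, 0 ≤ d ≤ k - s - 1 | l * C(s + d, d) ≡ 0 (mod 2)}`. -/
def omegaEven (k s l : ℕ) : Finset ℕ :=
  {d ∈ Finset.range (k - s) | Even d ∧ 2 ∣ l * (s + d).choose d}

/-- Solutions of the `J`-equality constraints such that in addition every `J_u` with
`|u| ∈ sizes` vanishes identically. -/
def jVanishing (k n s l : ℕ) (sizes : Set ℕ) : Set ((Fin k → Fin n) → ℝ) :=
  {y | JEqs s l y ∧ ∀ u : Finset (Fin k), u.card ∈ sizes → ∀ i, jChar y u i = 0}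

/-!
Write `P_u` for the orthogonal projection of `ℝ^(n^k)` onto the pure interactions of the columns
in `u`. With `E` the averaging matrix on the levels of one column, `P_u` is the tensor product of
`1 - E` over the columns in `u` and of `E` over the others, and `J_u = n ^ k P_u`
(`anova_eq_mulVec`). The `P_u` sum to `1` and `P_u` has trace `(n - 1) ^ |u|`.

The feasible set `F` is invariant under the wreath product of the symmetric groups on the levels
and on the columns, hence so is the direction `L` of its affine hull. The sum of the ranges of the
`P_u` with `|u| = j` is an irreducible representation, for each `j` a different one, so `L` is the
sum of some of them. The proof makes this explicit with the contrasts
`D = ∏_{j ∈ u} (δ_{a_j} - δ_{b_j})`: they span the range of `P_u`, the operator `y ↦ ⟨D, y⟩ D`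
belongs to the group algebra of the level permutations (`smul_contrast_mem`), and the contrasts on
sets of the same size are permuted transitively (`contrast_mem_of_card_eq`). A level swap that
negates `D` shows that if some `x ∈ F` has `⟨D, x⟩ ≠ 0`, then `L` contains an element not
orthogonal to `D`, hence `D` itself, hence the ranges of all `P_v` with `|v| = |u|`
(`interactionProj_mem_vectorSpan`). Therefore the affine hull of `F` is cut out by the
`J`-equalities and the equalities `J_u = 0` for the sizes `|u|` at which `J_u` vanishes on all of
`F` (`affineSpan_feasibleJ`), and the dimension of `L` is the trace of the projection onto it
(`finrank_vectorSpan_feasibleJ`).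

If `J_u` with `|u| = s + d` vanishes at a feasible `x`, expand it by inclusion and exclusion into
marginals. The term of `v ⊆ u` is `± n ^ |v|` times an integer; it is divisible by `n ^ (s + 1)`
for `|v| > s` and equals `± l n ^ s` for `|v| ≤ s`. The partial alternating sum of binomial
coefficients gives `n ∣ l C(s + d - 1, d - 1)` (`dvd_of_interactionProj_mulVec_eq_zero`).

For `n = 2`, adding one column to all the others modulo `2` maps interactions of odd size `m` not
containing that column to interactions of size `m + 1` and preserves feasibility when `s` is even.
So the sizes `m` and `m + 1` with `m` odd vanish together (`mem_vanishingSizes_succ_iff`).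
-/

open Matrix

/-! ### Tensor products of matrices and interaction projections -/

/-- The Kronecker product over all columns of the matrices `A j`. -/
noncomputable def tensorMatrix {k n : ℕ} (A : Fin k → Matrix (Fin n) (Fin n) ℝ) :
    Matrix (Fin k → Fin n) (Fin k → Fin n) ℝ :=
  Matrix.of fun i i' => ∏ j, A j (i j) (i' j)

/-- The averaging matrix on the levels of a single column. -/
noncomputable def meanMatrix (n : ℕ) : Matrix (Fin n) (Fin n) ℝ :=
  Matrix.of fun _ _ => (n : ℝ)⁻¹

/-- The orthogonal projection onto the functions that depend only on the columns in `u`. -/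
noncomputable def marginProj {k : ℕ} (n : ℕ) (u : Finset (Fin k)) :
    Matrix (Fin k → Fin n) (Fin k → Fin n) ℝ :=
  tensorMatrix fun j => if j ∈ u then 1 else meanMatrix n

/-- The orthogonal projection onto the pure interactions of the columns in `u`: the functions
of the columns in `u` whose sum over any single column of `u` vanishes. -/
noncomputable def interactionProj {k : ℕ} (n : ℕ) (u : Finset (Fin k)) :
    Matrix (Fin k → Fin n) (Fin k → Fin n) ℝ :=
  tensorMatrix fun j => if j ∈ u then 1 - meanMatrix n else meanMatrix n

section Tensor

variable {k n : ℕ}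

lemma tensorMatrix_apply (A : Fin k → Matrix (Fin n) (Fin n) ℝ) (i i' : Fin k → Fin n) :
    tensorMatrix A i i' = ∏ j, A j (i j) (i' j) := rfl

lemma tensorMatrix_mul (A B : Fin k → Matrix (Fin n) (Fin n) ℝ) :
    tensorMatrix A * tensorMatrix B = tensorMatrix (fun j => A j * B j) := by
  ext i i'
  simp only [Matrix.mul_apply, tensorMatrix_apply, Fintype.prod_sum, Finset.prod_mul_distrib]

lemma tensorMatrix_one :
    tensorMatrix (fun _ => 1 : Fin k → Matrix (Fin n) (Fin n) ℝ) = 1 := by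
  ext i i'
  by_cases h : i = i'
  · subst h; simp [tensorMatrix_apply]
  · obtain ⟨j, hj⟩ := Function.ne_iff.mp h
    rw [Matrix.one_apply_ne h, tensorMatrix_apply]
    exact Finset.prod_eq_zero (Finset.mem_univ j) (Matrix.one_apply_ne hj)

lemma tensorMatrix_eq_zero {A : Fin k → Matrix (Fin n) (Fin n) ℝ} {j : Fin k} (hj : A j = 0) :
    tensorMatrix A = 0 := by
  ext i i'
  exact Finset.prod_eq_zero (Finset.mem_univ j) (by simp [hj])

lemma tensorMatrix_smul (c : Fin k → ℝ) (A : Fin k → Matrix (Fin n) (Fin n) ℝ) :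
    tensorMatrix (fun j => c j • A j) = (∏ j, c j) • tensorMatrix A := by
  ext i i'
  simp [tensorMatrix_apply, Finset.prod_mul_distrib]

lemma trace_tensorMatrix (A : Fin k → Matrix (Fin n) (Fin n) ℝ) :
    (tensorMatrix A).trace = ∏ j, (A j).trace := by
  simp only [Matrix.trace, Matrix.diag_apply, tensorMatrix_apply, Fintype.prod_sum]

lemma tensorMatrix_add (A B : Fin k → Matrix (Fin n) (Fin n) ℝ) :
    tensorMatrix (fun j => A j + B j) =
      ∑ t : Finset (Fin k), tensorMatrix (fun j => if j ∈ t then A j else B j) := by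
  ext i i'
  simp only [Matrix.sum_apply, tensorMatrix_apply, Matrix.add_apply, Finset.prod_add,
    Finset.powerset_univ]
  refine Finset.sum_congr rfl fun t _ => ?_
  rw [← Finset.prod_mul_prod_compl t, ← Finset.compl_eq_univ_sdiff]
  congr 1
  · exact Finset.prod_congr rfl fun j hj => by simp [hj]
  · exact Finset.prod_congr rfl fun j hj => by simp [Finset.mem_compl.mp hj]

lemma meanMatrix_mul_self (hn : n ≠ 0) : meanMatrix n * meanMatrix n = meanMatrix n := by
  ext a b
  simp [meanMatrix, Matrix.mul_apply, hn]

lemma trace_meanMatrix (hn : n ≠ 0) : (meanMatrix n).trace = 1 := by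
  simp [meanMatrix, Matrix.trace, hn]

lemma trace_interactionProj (hn : n ≠ 0) (u : Finset (Fin k)) :
    (interactionProj n u).trace = ((n : ℝ) - 1) ^ u.card := by
  rw [interactionProj, trace_tensorMatrix]
  have : ∀ j : Fin k, (if j ∈ u then 1 - meanMatrix n else meanMatrix n).trace =
      if j ∈ u then (n : ℝ) - 1 else 1 := by
    intro j
    split_ifs <;> simp [trace_meanMatrix hn]
  simp [this]

/-- Splitting `1 = (1 - E) + E` in every column of `u`. -/
lemma marginProj_eq_sum (u : Finset (Fin k)) :
    marginProj n u = ∑ v ∈ u.powerset, interactionProj n v := by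
  have h : marginProj n u = tensorMatrix (fun j : Fin k =>
      (if j ∈ u then 1 - meanMatrix n else 0) + meanMatrix n) := by
    unfold marginProj
    congr 1
    funext j
    split_ifs <;> simp
  rw [h, tensorMatrix_add]
  symm
  refine Finset.sum_subset_zero_on_sdiff (Finset.subset_univ _) ?_ ?_
  · intro t ht
    simp only [Finset.mem_sdiff, Finset.mem_univ, true_and, Finset.mem_powerset,
      Finset.not_subset] at ht
    obtain ⟨j, hjt, hju⟩ := ht
    exact tensorMatrix_eq_zero (j := j) (by simp [hjt, hju])
  · intro t ht
    unfold interactionProj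
    congr 1
    funext j
    by_cases hj : j ∈ t
    · simp [hj, Finset.mem_powerset.mp ht hj]
    · simp [hj]

lemma sum_interactionProj : ∑ u : Finset (Fin k), interactionProj n u = 1 := by
  rw [← Finset.powerset_univ, ← marginProj_eq_sum, ← tensorMatrix_one]
  simp [marginProj]

/-- Expanding `1 - E` in every column of `u`. -/
lemma interactionProj_eq_sum (u : Finset (Fin k)) :
    interactionProj n u =
      ∑ v ∈ u.powerset, (-1 : ℝ) ^ (u \ v).card • marginProj n v := by
  have h : interactionProj n u = tensorMatrix (fun j : Fin k =>
      (if j ∈ u then 1 else 0) + (if j ∈ u then (-1 : ℝ) else 1) • meanMatrix n) := by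
    unfold interactionProj
    congr 1
    funext j
    split_ifs
    · simp [sub_eq_add_neg]
    · simp
  rw [h, tensorMatrix_add]
  symm
  refine Finset.sum_subset_zero_on_sdiff (Finset.subset_univ _) ?_ ?_
  · intro t ht
    simp only [Finset.mem_sdiff, Finset.mem_univ, true_and, Finset.mem_powerset,
      Finset.not_subset] at ht
    obtain ⟨j, hjt, hju⟩ := ht
    exact tensorMatrix_eq_zero (j := j) (by simp [hjt, hju])
  · intro t ht
    have hc : (-1 : ℝ) ^ (u \ t).card = ∏ j, if j ∈ u \ t then (-1 : ℝ) else 1 := by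
      rw [Fintype.prod_ite_mem, Finset.prod_const]
    rw [hc, marginProj, ← tensorMatrix_smul]
    congr 1
    funext j
    by_cases hj : j ∈ t
    · simp [hj, Finset.mem_powerset.mp ht hj]
    · simp [hj]

lemma interactionProj_mul_marginProj (hn : n ≠ 0) {u v : Finset (Fin k)} (h : u ⊆ v) :
    interactionProj n u * marginProj n v = interactionProj n u := by
  rw [interactionProj, marginProj, tensorMatrix_mul]
  congr 1
  funext j
  by_cases hu : j ∈ u
  · simp [hu, h hu]
  · by_cases hv : j ∈ v
    · simp [hv]
    · simp [hu, hv, meanMatrix_mul_self hn]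

lemma interactionProj_mul_marginProj_empty (hn : n ≠ 0) {u : Finset (Fin k)}
    (hu : u.Nonempty) : interactionProj n u * marginProj n ∅ = 0 := by
  obtain ⟨j, hj⟩ := hu
  rw [interactionProj, marginProj, tensorMatrix_mul]
  exact tensorMatrix_eq_zero (j := j) (by simp [hj, sub_mul, meanMatrix_mul_self hn])

lemma interactionProj_empty : interactionProj n (∅ : Finset (Fin k)) = marginProj n ∅ := by
  simp [interactionProj, marginProj]

lemma marginProj_mulVec (hn : n ≠ 0) (x : (Fin k → Fin n) → ℝ) (u : Finset (Fin k))
    (i : Fin k → Fin n) :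
    (marginProj n u *ᵥ x) i = (n : ℝ) ^ (-(k : ℤ) + (u.card : ℤ)) * marginalSum x u i := by
  have hn' : (n : ℝ) ≠ 0 := Nat.cast_ne_zero.mpr hn
  have hpow : (n : ℝ) ^ (-(k : ℤ) + (u.card : ℤ)) = ((n : ℝ)⁻¹) ^ uᶜ.card := by
    have : uᶜ.card + u.card = k := by simp [Finset.card_compl_add_card]
    rw [inv_pow, ← zpow_natCast, ← _root_.zpow_neg]
    congr 1
    omega
  rw [marginalSum, Finset.mul_sum, Finset.sum_filter, Matrix.mulVec, dotProduct]
  refine Finset.sum_congr rfl fun i' _ => ?_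
  rw [marginProj, tensorMatrix_apply]
  split_ifs with h
  · congr 1
    rw [hpow, ← Finset.prod_mul_prod_compl u, Finset.prod_eq_one, one_mul]
    · rw [← Finset.prod_const]
      exact Finset.prod_congr rfl fun j hj => by simp [Finset.mem_compl.mp hj, meanMatrix]
    · intro j hj
      rw [if_pos hj, h j hj, Matrix.one_apply_eq]
  · push Not at h
    obtain ⟨j, hj, hne⟩ := h
    rw [Finset.prod_eq_zero (Finset.mem_univ j), zero_mul]
    simp [hj, Matrix.one_apply_ne hne.symm]

/-- The recursively defined ANOVA interactions are the interaction projections. -/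
lemma anova_eq_mulVec (hn : n ≠ 0) (x : (Fin k → Fin n) → ℝ) (u : Finset (Fin k)) :
    ∀ i, anova x u i = (interactionProj n u *ᵥ x) i := by
  induction u using Finset.strongInduction with
  | H u ih =>
    intro i
    have hsum : ∑ v : {v : Finset (Fin k) // v ∈ u.ssubsets}, anova x v.1 i =
        ∑ v ∈ u.ssubsets, (interactionProj n v *ᵥ x) i := by
      rw [← Finset.sum_coe_sort u.ssubsets]
      exact Finset.sum_congr rfl fun v _ => ih v.1 (Finset.mem_ssubsets.mp v.2) i
    rw [anova, hsum, ← marginProj_mulVec hn, marginProj_eq_sum, Matrix.sum_mulVec,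
      Finset.sum_apply, Finset.ssubsets, sub_eq_iff_eq_add',
      Finset.sum_erase_add _ _ (Finset.mem_powerset_self u)]

end Tensor

/-! ### Contrasts and the action of the wreath product -/

section Contrast

variable {k n : ℕ}

/-- The tensor contrast `∏_{j ∈ u} (δ_{(p j).1} - δ_{(p j).2})`, a function of the columns
in `u` only. -/
noncomputable def contrast (u : Finset (Fin k)) (p : Fin k → Fin n × Fin n) :
    (Fin k → Fin n) → ℝ :=
  fun i => ∏ j, if j ∈ u then (Pi.single (p j).1 1 : Fin n → ℝ) (i j) -
    (Pi.single (p j).2 1 : Fin n → ℝ) (i j) else 1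

/-- `1 - E` is a multiple of the sum of the rank-one matrices of all differences
`δ_a - δ_b`. -/
lemma one_sub_meanMatrix_apply (hn : n ≠ 0) (c d : Fin n) :
    (1 - meanMatrix n) c d = (2 * (n : ℝ))⁻¹ * ∑ q : Fin n × Fin n,
      ((Pi.single q.1 1 : Fin n → ℝ) c - (Pi.single q.2 1 : Fin n → ℝ) c) *
        ((Pi.single q.1 1 : Fin n → ℝ) d - (Pi.single q.2 1 : Fin n → ℝ) d) := by
  have hn' : (n : ℝ) ≠ 0 := Nat.cast_ne_zero.mpr hn
  rw [Fintype.sum_prod_type]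
  simp only [sub_mul, mul_sub, Finset.sum_sub_distrib, Pi.single_apply, Matrix.sub_apply,
    Matrix.one_apply, meanMatrix, Matrix.of_apply]
  by_cases h : c = d
  · subst h
    simp
    field_simp
    ring
  · simp [h]
    field_simp
    ring

lemma meanMatrix_apply_eq_sum (hn : n ≠ 0) (c d : Fin n) :
    meanMatrix n c d = ((n : ℝ) ^ 3)⁻¹ * ∑ _q : Fin n × Fin n, (1 : ℝ) := by
  have hn' : (n : ℝ) ≠ 0 := Nat.cast_ne_zero.mpr hn
  simp [meanMatrix]
  field_simp

/-- The contrasts on `u` form a tight frame of the interactions of the columns in `u`. -/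
lemma exists_interactionProj_mulVec_eq (hn : n ≠ 0) (u : Finset (Fin k)) :
    ∃ c : ℝ, ∀ x : (Fin k → Fin n) → ℝ, interactionProj n u *ᵥ x =
      c • ∑ p : Fin k → Fin n × Fin n, (contrast u p ⬝ᵥ x) • contrast u p := by
  refine ⟨∏ j, if j ∈ u then (2 * (n : ℝ))⁻¹ else ((n : ℝ) ^ 3)⁻¹, fun x => ?_⟩
  have key : ∀ i i', interactionProj n u i i' =
      (∏ j, if j ∈ u then (2 * (n : ℝ))⁻¹ else ((n : ℝ) ^ 3)⁻¹) *
        ∑ p : Fin k → Fin n × Fin n, contrast u p i * contrast u p i' := by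
    intro i i'
    rw [interactionProj, tensorMatrix_apply]
    simp only [contrast, ← Finset.prod_mul_distrib]
    rw [← Fintype.prod_sum (fun j (q : Fin n × Fin n) =>
        (if j ∈ u then (Pi.single q.1 1 : Fin n → ℝ) (i j) -
          (Pi.single q.2 1 : Fin n → ℝ) (i j) else 1) *
        (if j ∈ u then (Pi.single q.1 1 : Fin n → ℝ) (i' j) -
          (Pi.single q.2 1 : Fin n → ℝ) (i' j) else 1)), ← Finset.prod_mul_distrib]
    refine Finset.prod_congr rfl fun j _ => ?_
    by_cases hj : j ∈ u
    · simp only [hj, if_true]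
      exact one_sub_meanMatrix_apply hn _ _
    · simp only [hj, if_false, mul_one]
      exact meanMatrix_apply_eq_sum hn _ _
  funext i
  simp only [Matrix.mulVec, dotProduct, key, Pi.smul_apply, Finset.sum_apply, smul_eq_mul,
    Finset.mul_sum, Finset.sum_mul]
  rw [Finset.sum_comm]
  refine Finset.sum_congr rfl fun p _ => Finset.sum_congr rfl fun i' _ => ?_
  ring

/-- The permutation of the runs that permutes the levels of column `j` by `π j`. -/
def levelPerm (π : Fin k → Equiv.Perm (Fin n)) : Equiv.Perm (Fin k → Fin n) :=
  Equiv.piCongrRight π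

/-- The permutation of the runs that permutes the columns. -/
def columnPerm (n : ℕ) (σ : Equiv.Perm (Fin k)) : Equiv.Perm (Fin k → Fin n) :=
  σ.arrowCongr (Equiv.refl _)

lemma levelPerm_apply (π : Fin k → Equiv.Perm (Fin n)) (i : Fin k → Fin n) (j : Fin k) :
    levelPerm π i j = π j (i j) := rfl

lemma columnPerm_apply (σ : Equiv.Perm (Fin k)) (i : Fin k → Fin n) (j : Fin k) :
    columnPerm n σ i j = i (σ.symm j) := rfl

/-- Invariance of a set of functions under the wreath product of the symmetric group on the
levels by the symmetric group on the columns. -/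
structure WreathInvariant (F : Set ((Fin k → Fin n) → ℝ)) : Prop where
  level : ∀ π, ∀ x ∈ F, x ∘ levelPerm π ∈ F
  column : ∀ σ, ∀ x ∈ F, x ∘ columnPerm n σ ∈ F

lemma comp_mem_vectorSpan {I : Type*} {F : Set (I → ℝ)} {e : I → I}
    (h : ∀ x ∈ F, x ∘ e ∈ F) {z : I → ℝ} (hz : z ∈ vectorSpan ℝ F) :
    z ∘ e ∈ vectorSpan ℝ F := by
  have hle : vectorSpan ℝ F ≤ (vectorSpan ℝ F).comap (LinearMap.funLeft ℝ ℝ e) := by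
    rw [vectorSpan_def, Submodule.span_le]
    rintro _ ⟨x, hx, y, hy, rfl⟩
    exact vsub_mem_vectorSpan ℝ (h x hx) (h y hy)
  exact hle hz

lemma WreathInvariant.vectorSpan {F : Set ((Fin k → Fin n) → ℝ)} (hF : WreathInvariant F) :
    WreathInvariant (vectorSpan ℝ F : Set ((Fin k → Fin n) → ℝ)) :=
  ⟨fun π _ hx => comp_mem_vectorSpan (hF.level π) hx,
    fun σ _ hx => comp_mem_vectorSpan (hF.column σ) hx⟩

/-- The matrices `(δ_a - δ_b)(δ_a - δ_b)ᵀ = 1 - (a b)` and `1 1ᵀ` of a single column are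
linear combinations of permutation matrices. -/
lemma exists_perm_combination (hn : n ≠ 0) (P : Prop) [Decidable P] (a b : Fin n)
    (hab : P → a ≠ b) :
    ∃ c : Equiv.Perm (Fin n) → ℝ, ∀ r r' : Fin n,
      ∑ π, c π * (if π r = r' then 1 else 0) =
        (if P then (Pi.single a 1 : Fin n → ℝ) r - (Pi.single b 1 : Fin n → ℝ) r else 1) *
        (if P then (Pi.single a 1 : Fin n → ℝ) r' - (Pi.single b 1 : Fin n → ℝ) r' else 1) := by
  have : NeZero n := ⟨hn⟩
  by_cases hP : P
  · refine ⟨Pi.single 1 1 - Pi.single (Equiv.swap a b) 1, fun r r' => ?_⟩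
    have hab := hab hP
    simp only [hP, if_true, Pi.sub_apply, sub_mul, Finset.sum_sub_distrib, Pi.single_apply,
      ite_mul, one_mul, zero_mul, Finset.sum_ite_eq', Finset.mem_univ, Equiv.Perm.one_apply,
      Equiv.swap_apply_def]
    grind
  · refine ⟨fun π => ∑ c : Fin n, if π = Equiv.addRight c then 1 else 0, fun r r' => ?_⟩
    simp only [hP, if_false, Finset.sum_mul, ite_mul, one_mul, zero_mul]
    rw [Finset.sum_comm]
    simp only [Finset.sum_ite_eq', Finset.mem_univ, if_true]
    rw [Finset.sum_eq_single (r' - r)]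
    · simp
    · intro c _ hc
      refine if_neg fun h => hc ?_
      rw [← h, Equiv.coe_addRight, add_sub_cancel_left]
    · simp

/-- The rank-one operator of a contrast lies in the group algebra of the level permutations. -/
lemma smul_contrast_mem (hn : n ≠ 0) {L : Submodule ℝ ((Fin k → Fin n) → ℝ)}
    (hL : WreathInvariant (L : Set ((Fin k → Fin n) → ℝ))) {u : Finset (Fin k)}
    {p : Fin k → Fin n × Fin n} (hp : ∀ j ∈ u, (p j).1 ≠ (p j).2)
    {z : (Fin k → Fin n) → ℝ} (hz : z ∈ L) : (contrast u p ⬝ᵥ z) • contrast u p ∈ L := by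
  choose C hC using fun j => exists_perm_combination hn (j ∈ u) (p j).1 (p j).2 (hp j)
  have h : (contrast u p ⬝ᵥ z) • contrast u p =
      ∑ π : Fin k → Equiv.Perm (Fin n), (∏ j, C j (π j)) • (z ∘ levelPerm π) := by
    funext i
    have h1 : ∀ π : Fin k → Equiv.Perm (Fin n), z (levelPerm π i) =
        ∑ i', (∏ j, if π j (i j) = i' j then (1 : ℝ) else 0) * z i' := by
      intro π
      rw [Finset.sum_eq_single (levelPerm π i)]
      · simp [levelPerm_apply]
      · intro i' _ hne
        obtain ⟨j, hj⟩ := Function.ne_iff.mp hne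
        rw [Finset.prod_eq_zero (Finset.mem_univ j), zero_mul]
        exact if_neg (Ne.symm hj)
      · simp
    simp only [Pi.smul_apply, Finset.sum_apply, smul_eq_mul, Function.comp_apply, h1,
      Finset.mul_sum, dotProduct, Finset.sum_mul]
    rw [Finset.sum_comm]
    refine Finset.sum_congr rfl fun i' _ => ?_
    have h2 : contrast u p i * contrast u p i' =
        ∑ π : Fin k → Equiv.Perm (Fin n), ∏ j, C j (π j) *
          (if π j (i j) = i' j then (1 : ℝ) else 0) := by
      rw [← Fintype.prod_sum (fun j (π : Equiv.Perm (Fin n)) =>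
        C j π * (if π (i j) = i' j then (1 : ℝ) else 0))]
      simp only [hC, Finset.prod_mul_distrib, contrast]
    rw [mul_right_comm, mul_comm (contrast u p i'), h2, Finset.sum_mul]
    refine Finset.sum_congr rfl fun π _ => ?_
    rw [Finset.prod_mul_distrib, mul_assoc]
  rw [h]
  exact L.sum_mem fun π _ => L.smul_mem _ (hL.level π z hz)

lemma contrast_eq_zero {u : Finset (Fin k)} {p : Fin k → Fin n × Fin n} {j : Fin k}
    (hj : j ∈ u) (h : (p j).1 = (p j).2) : contrast u p = 0 := by
  funext i
  exact Finset.prod_eq_zero (Finset.mem_univ j) (by simp [hj, h])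

/-- The wreath product acts transitively on the contrasts of nonzero differences on sets of
columns of a given size. -/
lemma contrast_mem_of_card_eq {L : Submodule ℝ ((Fin k → Fin n) → ℝ)}
    (hL : WreathInvariant (L : Set ((Fin k → Fin n) → ℝ))) {u v : Finset (Fin k)}
    {p q : Fin k → Fin n × Fin n} (hp : ∀ j ∈ u, (p j).1 ≠ (p j).2)
    (hq : ∀ j ∈ v, (q j).1 ≠ (q j).2) (huv : u.card = v.card) (h : contrast u p ∈ L) :
    contrast v q ∈ L := by
  obtain ⟨σ, hσ⟩ : ∃ σ : Equiv.Perm (Fin k), ∀ j, σ j ∈ v ↔ j ∈ u := by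
    obtain ⟨σ, hσ⟩ := Equiv.Perm.exists_map_finset_eq u v huv
    exact ⟨σ, fun j => by simp [← hσ]⟩
  have hπ : ∀ j, ∃ π : Equiv.Perm (Fin n), j ∈ v →
      π (q j).1 = (p (σ.symm j)).1 ∧ π (q j).2 = (p (σ.symm j)).2 := by
    intro j
    by_cases hj : j ∈ v
    · have hj' : σ.symm j ∈ u := by rw [← hσ, Equiv.apply_symm_apply]; exact hj
      obtain ⟨π, hπ⟩ := Equiv.Perm.exists_extending_pair
        ![(q j).1, (q j).2] ![(p (σ.symm j)).1, (p (σ.symm j)).2]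
        (by simpa [Function.Injective, Fin.forall_fin_two, eq_comm] using hq j hj)
        (by simpa [Function.Injective, Fin.forall_fin_two, eq_comm] using hp _ hj')
      exact ⟨π, fun _ => ⟨hπ 0, hπ 1⟩⟩
    · exact ⟨1, fun h => absurd h hj⟩
  choose π hπ using hπ
  have : contrast v q = (contrast u p ∘ columnPerm n σ.symm) ∘ levelPerm π := by
    funext i
    simp only [contrast, Function.comp_apply, columnPerm_apply, levelPerm_apply,
      Equiv.symm_symm]
    rw [← Equiv.prod_comp σ]
    refine Finset.prod_congr rfl fun j _ => ?_
    simp only [hσ]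
    split_ifs with hj
    · obtain ⟨h1, h2⟩ := hπ (σ j) ((hσ j).mpr hj)
      rw [Equiv.symm_apply_apply] at h1 h2
      simp only [Pi.single_apply, ← h1, ← h2, (π (σ j)).apply_eq_iff_eq]
    · rfl
  rw [this]
  exact hL.level _ _ (hL.column _ _ h)

/-- Swapping the two levels of one factor changes the sign of a contrast. -/
lemma contrast_dotProduct_comp_swap {u : Finset (Fin k)} {p : Fin k → Fin n × Fin n}
    {j₀ : Fin k} (hj₀ : j₀ ∈ u) (x : (Fin k → Fin n) → ℝ) :
    contrast u p ⬝ᵥ (x ∘ levelPerm (Pi.mulSingle j₀ (Equiv.swap (p j₀).1 (p j₀).2))) =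
      -(contrast u p ⬝ᵥ x) := by
  set e := levelPerm (Pi.mulSingle j₀ (Equiv.swap (p j₀).1 (p j₀).2)) with he
  have h : ∀ i, contrast u p i = - contrast u p (e i) := by
    intro i
    rw [contrast, contrast, ← Finset.mul_prod_erase _ _ (Finset.mem_univ j₀),
      ← Finset.mul_prod_erase _ _ (Finset.mem_univ j₀), ← neg_mul]
    congr 1
    · simp only [hj₀, if_true, he, levelPerm_apply, Pi.mulSingle_eq_same, Pi.single_apply,
        Equiv.swap_apply_def]
      grind
    · refine Finset.prod_congr rfl fun j hj => ?_
      have hej : e i j = i j := by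
        rw [he, levelPerm_apply, Pi.mulSingle_eq_of_ne (Finset.ne_of_mem_erase hj),
          Equiv.Perm.one_apply]
      rw [hej]
  simp only [dotProduct, ← Finset.sum_neg_distrib, Function.comp_apply]
  rw [← Equiv.sum_comp e (fun i => -(contrast u p i * x i))]
  exact Finset.sum_congr rfl fun i _ => by rw [h i, neg_mul]

/-- A nonzero interaction of one point of `F` forces all interactions of that size into the
direction of the affine hull. -/
lemma interactionProj_mem_vectorSpan (hn : n ≠ 0) {F : Set ((Fin k → Fin n) → ℝ)}
    (hF : WreathInvariant F) {x : (Fin k → Fin n) → ℝ} (hx : x ∈ F) {u v : Finset (Fin k)}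
    (hu : u.Nonempty) (hxu : interactionProj n u *ᵥ x ≠ 0) (huv : u.card = v.card)
    (z : (Fin k → Fin n) → ℝ) : interactionProj n v *ᵥ z ∈ vectorSpan ℝ F := by
  obtain ⟨p, hpx⟩ : ∃ p, contrast u p ⬝ᵥ x ≠ 0 := by
    by_contra! hall
    obtain ⟨c, hc⟩ := exists_interactionProj_mulVec_eq hn u
    exact hxu (by simp [hc, hall])
  have hp : ∀ j ∈ u, (p j).1 ≠ (p j).2 := fun j hj h =>
    hpx (by rw [contrast_eq_zero hj h, zero_dotProduct])
  obtain ⟨j₀, hj₀⟩ := hu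
  have hmem := smul_contrast_mem hn hF.vectorSpan hp (vsub_mem_vectorSpan ℝ hx
    (hF.level (Pi.mulSingle j₀ (Equiv.swap (p j₀).1 (p j₀).2)) x hx))
  rw [vsub_eq_sub, dotProduct_sub, contrast_dotProduct_comp_swap hj₀, sub_neg_eq_add,
    Submodule.smul_mem_iff _ (by simpa [← two_mul] using hpx)] at hmem
  obtain ⟨c, hc⟩ := exists_interactionProj_mulVec_eq hn v
  rw [hc]
  refine Submodule.smul_mem _ _ (Submodule.sum_mem _ fun q _ => Submodule.smul_mem _ _ ?_)
  by_cases hq : ∀ j ∈ v, (q j).1 ≠ (q j).2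
  · exact contrast_mem_of_card_eq hF.vectorSpan hp hq huv hmem
  · push Not at hq
    obtain ⟨j, hj, h⟩ := hq
    rw [contrast_eq_zero hj h]
    exact Submodule.zero_mem _

end Contrast

/-! ### The constraints in terms of interaction projections -/

section Feasible

variable {k n s l p : ℕ}

lemma jChar_eq_zero_iff (hn : n ≠ 0) (x : (Fin k → Fin n) → ℝ) (u : Finset (Fin k)) :
    (∀ i, jChar x u i = 0) ↔ interactionProj n u *ᵥ x = 0 := by
  have hn' : (n : ℝ) ^ k ≠ 0 := pow_ne_zero _ (Nat.cast_ne_zero.mpr hn)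
  simp [funext_iff, jChar, hn', anova_eq_mulVec hn]

lemma jEqs_iff (hn : n ≠ 0) (x : (Fin k → Fin n) → ℝ) :
    JEqs s l x ↔
      (interactionProj n ∅ *ᵥ x = fun _ => (l : ℝ) * (n : ℝ) ^ s / (n : ℝ) ^ k) ∧
      ∀ u : Finset (Fin k), u.Nonempty → u.card ≤ s → interactionProj n u *ᵥ x = 0 := by
  have hn' : (n : ℝ) ^ k ≠ 0 := pow_ne_zero _ (Nat.cast_ne_zero.mpr hn)
  simp only [JEqs, jChar_eq_zero_iff hn, Finset.one_le_card]
  simp only [funext_iff, jChar, anova_eq_mulVec hn, eq_div_iff hn', mul_comm ((n : ℝ) ^ k)]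

lemma jVanishing_iff (hn : n ≠ 0) (x : (Fin k → Fin n) → ℝ) (sizes : Set ℕ) :
    x ∈ jVanishing k n s l sizes ↔ JEqs s l x ∧
      ∀ u : Finset (Fin k), u.card ∈ sizes → interactionProj n u *ᵥ x = 0 := by
  simp only [jVanishing, Set.mem_ofPred_eq, jChar_eq_zero_iff hn]

/-- Under the `J`-equalities every marginal on at most `s` columns is constant. -/
lemma JEqs.marginProj_mulVec (hn : n ≠ 0) {x : (Fin k → Fin n) → ℝ} (hx : JEqs s l x)
    {u : Finset (Fin k)} (hu : u.card ≤ s) :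
    marginProj n u *ᵥ x = fun _ => (l : ℝ) * (n : ℝ) ^ s / (n : ℝ) ^ k := by
  obtain ⟨h0, h1⟩ := (jEqs_iff hn x).mp hx
  rw [marginProj_eq_sum, Matrix.sum_mulVec, ← h0]
  refine Finset.sum_eq_single ∅ (fun v hv hne => ?_) (by simp)
  exact h1 v (Finset.nonempty_iff_ne_empty.mpr hne)
    ((Finset.card_le_card (Finset.mem_powerset.mp hv)).trans hu)

lemma marginProj_mulVec_eq_const_iff (hn : n ≠ 0) (x : (Fin k → Fin n) → ℝ)
    (u : Finset (Fin k)) (c : ℝ) :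
    (marginProj n u *ᵥ x = fun _ => c * (n : ℝ) ^ u.card / (n : ℝ) ^ k) ↔
      ∀ i, marginalSum x u i = c := by
  have hn' : (n : ℝ) ≠ 0 := Nat.cast_ne_zero.mpr hn
  rw [funext_iff]
  refine forall_congr' fun i => ?_
  rw [_root_.marginProj_mulVec hn, zpow_add₀ hn', _root_.zpow_neg, zpow_natCast, zpow_natCast]
  field_simp

lemma marginProj_empty_mulVec_const (hn : n ≠ 0) (c : ℝ) :
    marginProj n (∅ : Finset (Fin k)) *ᵥ (fun _ => c) = fun _ => c := by
  have hn' : (n : ℝ) ≠ 0 := Nat.cast_ne_zero.mpr hn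
  funext i
  rw [_root_.marginProj_mulVec hn]
  simp [marginalSum, hn']

lemma marginalEqs_iff_jEqs (hn : n ≠ 0) (hsk : s ≤ k) (x : (Fin k → Fin n) → ℝ) :
    MarginalEqs s l x ↔ JEqs s l x := by
  constructor
  · intro h
    have hP : ∀ w : Finset (Fin k), w.card ≤ s → interactionProj n w *ᵥ x =
        interactionProj n w *ᵥ (fun _ => (l : ℝ) * (n : ℝ) ^ s / (n : ℝ) ^ k) := by
      intro w hw
      obtain ⟨u, hwu, hu⟩ := Finset.exists_superset_card_eq hw (by simpa using hsk)
      have hconst := (marginProj_mulVec_eq_const_iff hn x u l).mpr (h u hu)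
      rw [hu] at hconst
      rw [← hconst, Matrix.mulVec_mulVec, interactionProj_mul_marginProj hn hwu]
    refine (jEqs_iff hn x).mpr ⟨?_, fun u hu hus => ?_⟩
    · rw [hP ∅ (by simp), interactionProj_empty, marginProj_empty_mulVec_const hn]
    · rw [hP u hus, ← marginProj_empty_mulVec_const hn, Matrix.mulVec_mulVec,
        interactionProj_mul_marginProj_empty hn hu, Matrix.zero_mulVec]
  · intro h u hu
    rw [← marginProj_mulVec_eq_const_iff hn, h.marginProj_mulVec hn hu.le, hu]

lemma feasible_eq_feasibleJ (hn : n ≠ 0) (hsk : s ≤ k) :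
    feasible k n s l p = feasibleJ k n s l p := by
  ext x
  simp only [feasible, feasibleJ, Set.mem_ofPred_eq, marginalEqs_iff_jEqs hn hsk]

end Feasible

/-! ### Symmetries of the feasible set -/

section Symmetry

variable {k n s l p : ℕ}

lemma mulVec_comp_equiv {I : Type*} [Fintype I] (e : Equiv.Perm I) {K K' : Matrix I I ℝ}
    (h : ∀ i i', K' i i' = K (e i) (e i')) (x : I → ℝ) : K' *ᵥ (x ∘ e) = (K *ᵥ x) ∘ e := by
  funext i
  simp only [Matrix.mulVec, dotProduct, Function.comp_apply, h]
  exact Equiv.sum_comp e (fun i' => K (e i) i' * x i')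

lemma interactionProj_levelPerm (u : Finset (Fin k)) (π : Fin k → Equiv.Perm (Fin n))
    (i i' : Fin k → Fin n) :
    interactionProj n u i i' = interactionProj n u (levelPerm π i) (levelPerm π i') := by
  simp only [interactionProj, tensorMatrix_apply, levelPerm_apply]
  refine Finset.prod_congr rfl fun j _ => ?_
  split_ifs <;> simp [meanMatrix, Matrix.one_apply]

lemma interactionProj_columnPerm (u : Finset (Fin k)) (σ : Equiv.Perm (Fin k))
    (i i' : Fin k → Fin n) :
    interactionProj n (u.map σ.symm.toEmbedding) i i' =
      interactionProj n u (columnPerm n σ i) (columnPerm n σ i') := by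
  simp only [interactionProj, tensorMatrix_apply, columnPerm_apply]
  rw [← Equiv.prod_comp σ.symm]
  refine Finset.prod_congr rfl fun j _ => ?_
  simp

/-- A permutation of the runs that permutes the interaction projections among each other, and
those of sizes `0` and `1, …, s` separately, preserves feasibility. -/
lemma comp_mem_feasibleJ (hn : n ≠ 0) (e : Equiv.Perm (Fin k → Fin n))
    (w : Finset (Fin k) → Finset (Fin k))
    (hw : ∀ u i i', interactionProj n u i i' = interactionProj n (w u) (e i) (e i'))
    (hw0 : w ∅ = ∅) (hws : ∀ u : Finset (Fin k), u.Nonempty → u.card ≤ s →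
      (w u).Nonempty ∧ (w u).card ≤ s)
    {x : (Fin k → Fin n) → ℝ} (hx : x ∈ feasibleJ k n s l p) : x ∘ e ∈ feasibleJ k n s l p := by
  obtain ⟨hJ, hbox⟩ := hx
  obtain ⟨h0, h1⟩ := (jEqs_iff hn x).mp hJ
  refine ⟨(jEqs_iff hn _).mpr ⟨?_, fun u hu hus => ?_⟩, fun i => hbox (e i)⟩
  · rw [mulVec_comp_equiv e (hw ∅), hw0, h0]
    rfl
  · rw [mulVec_comp_equiv e (hw u), h1 _ (hws u hu hus).1 (hws u hu hus).2]
    rfl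

lemma wreathInvariant_feasibleJ (hn : n ≠ 0) : WreathInvariant (feasibleJ k n s l p) where
  level π x hx := comp_mem_feasibleJ hn _ id (fun u => interactionProj_levelPerm u π) rfl
    (fun _ h h' => ⟨h, h'⟩) hx
  column σ x hx := by
    refine comp_mem_feasibleJ hn _ (fun u => u.map σ.toEmbedding) (fun u i i' => ?_) rfl
      (fun u h h' => by simpa using ⟨h, h'⟩) hx
    rw [← interactionProj_columnPerm]
    congr 1
    ext j
    simp

end Symmetry

/-! ### The affine hull and its dimension -/

section AffineHull

variable {k n s l p : ℕ}

/-- The sizes `m > s` for which all interactions of `m` columns vanish on every feasible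
point. -/
noncomputable def vanishingSizes (k n s l p : ℕ) : Finset ℕ := by
  classical
  exact {m ∈ Finset.Icc (s + 1) k | ∀ x ∈ feasibleJ k n s l p, ∀ u : Finset (Fin k),
    u.card = m → interactionProj n u *ᵥ x = 0}

lemma mem_vanishingSizes {m : ℕ} : m ∈ vanishingSizes k n s l p ↔ (s + 1 ≤ m ∧ m ≤ k) ∧
    ∀ x ∈ feasibleJ k n s l p, ∀ u : Finset (Fin k), u.card = m →
      interactionProj n u *ᵥ x = 0 := by
  simp [vanishingSizes]

/-- The sizes of the interactions that are constant on the feasible points. -/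
noncomputable def fixedSizes (k n s l p : ℕ) : Finset ℕ :=
  Finset.range (s + 1) ∪ vanishingSizes k n s l p

/-- The projection onto the interactions that are not constant on the feasible points. -/
noncomputable def directionProj (k n s l p : ℕ) : Matrix (Fin k → Fin n) (Fin k → Fin n) ℝ :=
  ∑ u : Finset (Fin k) with u.card ∉ fixedSizes k n s l p, interactionProj n u

lemma directionProj_mulVec_mem (hn : n ≠ 0) (z : (Fin k → Fin n) → ℝ) :
    directionProj k n s l p *ᵥ z ∈ vectorSpan ℝ (feasibleJ k n s l p) := by
  rw [directionProj, Matrix.sum_mulVec]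
  refine Submodule.sum_mem _ fun v hv => ?_
  obtain ⟨hvs, hv⟩ : s < v.card ∧ v.card ∉ vanishingSizes k n s l p := by
    simpa [fixedSizes, Nat.lt_succ_iff] using hv
  have hvk : v.card ≤ k := by simpa using Finset.card_le_univ v
  simp only [mem_vanishingSizes, hvk, Nat.succ_le_iff.mpr hvs, true_and, not_forall] at hv
  obtain ⟨x, hx, u, huv, hxu⟩ := hv
  refine interactionProj_mem_vectorSpan hn (wreathInvariant_feasibleJ hn) hx ?_ hxu huv z
  rw [← Finset.card_pos]
  omega

lemma directionProj_mulVec_eq_self {z : (Fin k → Fin n) → ℝ}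
    (hz : ∀ u : Finset (Fin k), u.card ∈ fixedSizes k n s l p → interactionProj n u *ᵥ z = 0) :
    directionProj k n s l p *ᵥ z = z := by
  have h : ∑ u : Finset (Fin k), interactionProj n u *ᵥ z = z := by
    rw [← Matrix.sum_mulVec, sum_interactionProj, Matrix.one_mulVec]
  conv_rhs => rw [← h]
  rw [directionProj, Matrix.sum_mulVec]
  refine Finset.sum_subset (Finset.filter_subset _ _) fun u _ hu => hz u ?_
  simpa using hu

lemma interactionProj_mulVec_sub_eq_zero (hn : n ≠ 0) {x y : (Fin k → Fin n) → ℝ}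
    (hx : x ∈ jVanishing k n s l (vanishingSizes k n s l p))
    (hy : y ∈ jVanishing k n s l (vanishingSizes k n s l p)) (u : Finset (Fin k))
    (hu : u.card ∈ fixedSizes k n s l p) : interactionProj n u *ᵥ (x - y) = 0 := by
  rw [jVanishing_iff hn, jEqs_iff hn] at hx hy
  rw [Matrix.mulVec_sub, sub_eq_zero]
  rcases Finset.mem_union.mp hu with h | h
  · rcases u.eq_empty_or_nonempty with rfl | hne
    · rw [hx.1.1, hy.1.1]
    · have hus : u.card ≤ s := Nat.lt_succ_iff.mp (Finset.mem_range.mp h)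
      rw [hx.1.2 u hne hus, hy.1.2 u hne hus]
  · rw [hx.2 u h, hy.2 u h]

lemma feasibleJ_subset_jVanishing (hn : n ≠ 0) :
    feasibleJ k n s l p ⊆ jVanishing k n s l (vanishingSizes k n s l p) := fun x hx =>
  (jVanishing_iff hn x _).mpr ⟨hx.1, fun u hu => (mem_vanishingSizes.mp hu).2 x hx u rfl⟩

lemma interactionProj_mulVec_eq_zero_of_mem_vectorSpan (hn : n ≠ 0) {z : (Fin k → Fin n) → ℝ}
    (hz : z ∈ vectorSpan ℝ (feasibleJ k n s l p)) (u : Finset (Fin k))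
    (hu : u.card ∈ fixedSizes k n s l p) : interactionProj n u *ᵥ z = 0 := by
  have hle : vectorSpan ℝ (feasibleJ k n s l p) ≤
      LinearMap.ker (Matrix.toLin' (interactionProj n u)) := by
    rw [vectorSpan_def, Submodule.span_le]
    rintro _ ⟨x, hx, y, hy, rfl⟩
    simpa using interactionProj_mulVec_sub_eq_zero hn (feasibleJ_subset_jVanishing hn hx)
      (feasibleJ_subset_jVanishing hn hy) u hu
  simpa using hle hz

lemma affineSpan_feasibleJ (hn : n ≠ 0) {x : (Fin k → Fin n) → ℝ}
    (hx : x ∈ feasibleJ k n s l p) :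
    (affineSpan ℝ (feasibleJ k n s l p) : Set ((Fin k → Fin n) → ℝ)) =
      jVanishing k n s l (vanishingSizes k n s l p) := by
  have hxJ := feasibleJ_subset_jVanishing hn hx
  ext y
  rw [SetLike.mem_coe, ← AffineSubspace.vsub_right_mem_direction_iff_mem
    (subset_affineSpan ℝ _ hx), direction_affineSpan, vsub_eq_sub]
  constructor
  · intro h
    have h0 := interactionProj_mulVec_eq_zero_of_mem_vectorSpan hn h
    simp only [Matrix.mulVec_sub, sub_eq_zero] at h0
    rw [jVanishing_iff hn, jEqs_iff hn] at hxJ ⊢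
    refine ⟨⟨?_, fun u hu hus => ?_⟩, fun u hu => ?_⟩
    · rw [h0 ∅ (by simp [fixedSizes]), hxJ.1.1]
    · rw [h0 u (by simp [fixedSizes, hus]), hxJ.1.2 u hu hus]
    · rw [h0 u (Finset.mem_union_right _ hu), hxJ.2 u hu]
  · intro hy
    rw [← directionProj_mulVec_eq_self (interactionProj_mulVec_sub_eq_zero hn hy hxJ)]
    exact directionProj_mulVec_mem hn _

lemma sum_finset_card (f : ℕ → ℤ) :
    ∑ u : Finset (Fin k), f u.card = ∑ j ∈ Finset.range (k + 1), (k.choose j : ℤ) * f j := by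
  rw [← Finset.powerset_univ, Finset.sum_powerset_apply_card]
  simp

/-- The direction of the affine hull is the image of `directionProj`, so that its dimension is
the trace of this projection. -/
lemma finrank_vectorSpan_feasibleJ (hn : n ≠ 0) (hsk : s ≤ k) :
    (Module.finrank ℝ (vectorSpan ℝ (feasibleJ k n s l p)) : ℤ) =
      (n : ℤ) ^ k - ∑ j ∈ Finset.range (s + 1), (k.choose j : ℤ) * ((n : ℤ) - 1) ^ j -
        ∑ j ∈ vanishingSizes k n s l p, (k.choose j : ℤ) * ((n : ℤ) - 1) ^ j := by
  have hproj : LinearMap.IsProj (vectorSpan ℝ (feasibleJ k n s l p))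
      (Matrix.toLin' (directionProj k n s l p)) :=
    ⟨fun z => directionProj_mulVec_mem hn z, fun z hz => directionProj_mulVec_eq_self
      (interactionProj_mulVec_eq_zero_of_mem_vectorSpan hn hz)⟩
  have htr : (Module.finrank ℝ (vectorSpan ℝ (feasibleJ k n s l p)) : ℤ) =
      ∑ u : Finset (Fin k) with u.card ∉ fixedSizes k n s l p, ((n : ℤ) - 1) ^ u.card := by
    have h := hproj.trace
    rw [Matrix.trace_toLin'_eq, directionProj, Matrix.trace_sum] at h
    simp only [trace_interactionProj hn] at h
    exact_mod_cast h.symm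
  have hpow : (n : ℤ) ^ k =
      ∑ j ∈ Finset.range (k + 1), (k.choose j : ℤ) * ((n : ℤ) - 1) ^ j := by
    have := add_pow ((n : ℤ) - 1) 1 k
    simpa [mul_comm] using this
  have hsub : fixedSizes k n s l p ⊆ Finset.range (k + 1) := by
    intro j hj
    simp only [fixedSizes, Finset.mem_union, Finset.mem_range, mem_vanishingSizes] at hj ⊢
    omega
  have hdisj : Disjoint (Finset.range (s + 1)) (vanishingSizes k n s l p) := by
    rw [Finset.disjoint_left]
    intro j hj hj'
    simp only [Finset.mem_range, mem_vanishingSizes] at hj hj'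
    omega
  rw [htr, Finset.sum_filter,
    sum_finset_card fun j => if j ∉ fixedSizes k n s l p then ((n : ℤ) - 1) ^ j else 0,
    hpow, sub_sub, ← Finset.sum_union hdisj, eq_sub_iff_add_eq, ← fixedSizes]
  simp only [mul_ite, mul_zero]
  rw [← Finset.sum_filter, ← Finset.sum_sdiff hsub, Finset.sdiff_eq_filter]

end AffineHull

/-! ### Divisibility from a vanishing interaction -/

section Divisibility

variable {k n s l p : ℕ}

lemma sum_powerset_filter_card_le (u : Finset (Fin k)) {d : ℕ} (hu : u.card = s + d)
    (hd : 1 ≤ d) :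
    ∑ v ∈ u.powerset with v.card ≤ s, (-1 : ℤ) ^ (u \ v).card =
      (-1) ^ d * ((s + d - 1).choose (d - 1) : ℤ) := by
  have h1 : ∑ v ∈ u.powerset with v.card ≤ s, (-1 : ℤ) ^ (u \ v).card =
      ∑ v ∈ u.powerset, if v.card ≤ s then (-1 : ℤ) ^ (s + d) * (-1) ^ v.card else 0 := by
    rw [Finset.sum_filter]
    refine Finset.sum_congr rfl fun v hv => ?_
    have hvu := Finset.mem_powerset.mp hv
    have hc : (u \ v).card + v.card = s + d := by rw [Finset.card_sdiff_add_card_eq_card hvu, hu]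
    rw [← hc, pow_add, mul_assoc, ← pow_add, ← two_mul, pow_mul]
    simp
  rw [h1, Finset.sum_powerset_apply_card
    (fun m => if m ≤ s then (-1 : ℤ) ^ (s + d) * (-1) ^ m else 0), hu]
  have h2 : ∑ m ∈ Finset.range (s + d + 1),
      (s + d).choose m • (if m ≤ s then (-1 : ℤ) ^ (s + d) * (-1) ^ m else 0) =
      (-1) ^ (s + d) *
        ∑ m ∈ Finset.range (s + 1), (-1 : ℤ) ^ m * ((s + d - 1 + 1).choose m : ℤ) := by
    rw [Finset.mul_sum, ← Finset.sum_subset (Finset.range_mono (show s + 1 ≤ s + d + 1 by omega))]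
    · refine Finset.sum_congr rfl fun m hm => ?_
      rw [if_pos (Nat.lt_succ_iff.mp (Finset.mem_range.mp hm)), nsmul_eq_mul,
        show s + d - 1 + 1 = s + d by omega]
      ring
    · intro m _ hm
      rw [if_neg (by simpa using hm), smul_zero]
  rw [h2, Int.alternating_sum_range_choose_eq_choose, ← mul_assoc, ← pow_add,
    show s + d + s = 2 * s + d by ring, pow_add, pow_mul,
    ← Nat.choose_symm_of_eq_add (show s + d - 1 = d - 1 + s by omega)]
  simp

/-- Modulo `n ^ (s + 1)`, the `J`-characteristic of `s + d` columns of a feasible point equals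
`± l n ^ s C(s + d - 1, d - 1)`: the marginals on more than `s` columns enter with a factor
`n ^ (s + 1)`, and those on at most `s` columns are known. -/
lemma dvd_of_interactionProj_mulVec_eq_zero (hn : n ≠ 0) {x : (Fin k → Fin n) → ℝ}
    (hx : x ∈ feasibleJ k n s l p) {u : Finset (Fin k)} {d : ℕ} (hu : u.card = s + d)
    (hd : 1 ≤ d) (h : interactionProj n u *ᵥ x = 0) :
    n ∣ l * (s + d - 1).choose (d - 1) := by
  have hn' : (n : ℝ) ≠ 0 := Nat.cast_ne_zero.mpr hn
  have : NeZero n := ⟨hn⟩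
  obtain ⟨hJ, hbox⟩ := hx
  choose z hz using fun i => (hbox i).2.2
  set i₀ : Fin k → Fin n := fun _ => 0
  -- the integral marginals at `i₀`
  have hM : ∀ v : Finset (Fin k), ∃ m : ℤ, marginalSum x v i₀ = m := by
    intro v
    refine ⟨∑ i' with ∀ j ∈ v, i' j = i₀ j, z i', ?_⟩
    rw [marginalSum]
    push_cast
    exact Finset.sum_congr rfl fun i' _ => hz i'
  choose m hm using hM
  have hE : ∀ v : Finset (Fin k),
      (n : ℝ) ^ k * (marginProj n v *ᵥ x) i₀ = ((n : ℤ) ^ v.card * m v : ℤ) := by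
    intro v
    rw [marginProj_mulVec hn, hm, zpow_add₀ hn', _root_.zpow_neg, zpow_natCast, zpow_natCast]
    push_cast
    field_simp
  have hsmall : ∀ v : Finset (Fin k), v.card ≤ s →
      (n : ℤ) ^ v.card * m v = (l : ℤ) * (n : ℤ) ^ s := by
    intro v hv
    have := hE v
    rw [hJ.marginProj_mulVec hn hv, mul_div_cancel₀ _ (pow_ne_zero k hn')] at this
    exact_mod_cast this.symm
  have hzero : ∑ v ∈ u.powerset, (-1 : ℤ) ^ (u \ v).card * ((n : ℤ) ^ v.card * m v) = 0 := by
    have h0 : (n : ℝ) ^ k * (interactionProj n u *ᵥ x) i₀ = 0 := by rw [h]; simp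
    rw [interactionProj_eq_sum, Matrix.sum_mulVec, Finset.sum_apply, Finset.mul_sum] at h0
    have h1 : ∀ v, (n : ℝ) ^ k * (((-1 : ℝ) ^ (u \ v).card • marginProj n v) *ᵥ x) i₀ =
        ((-1 : ℤ) ^ (u \ v).card * ((n : ℤ) ^ v.card * m v) : ℤ) := by
      intro v
      rw [Matrix.smul_mulVec, Pi.smul_apply, smul_eq_mul, mul_left_comm, hE v]
      push_cast
      ring
    simp only [h1] at h0
    exact_mod_cast h0
  rw [← Finset.sum_filter_add_sum_filter_not _ (fun v : Finset (Fin k) => v.card ≤ s)] at hzero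
  have hlow : ∑ v ∈ u.powerset with v.card ≤ s,
      (-1 : ℤ) ^ (u \ v).card * ((n : ℤ) ^ v.card * m v) =
      (n : ℤ) ^ s * ((-1) ^ d * ((l * (s + d - 1).choose (d - 1) : ℕ) : ℤ)) := by
    rw [Finset.sum_congr rfl fun v hv => by rw [hsmall v (Finset.mem_filter.mp hv).2],
      ← Finset.sum_mul, sum_powerset_filter_card_le u hu hd]
    push_cast
    ring
  have hhigh : (n : ℤ) ^ s * n ∣ ∑ v ∈ u.powerset with ¬ v.card ≤ s,
      (-1 : ℤ) ^ (u \ v).card * ((n : ℤ) ^ v.card * m v) := by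
    refine Finset.dvd_sum fun v hv => Dvd.dvd.mul_left (Dvd.dvd.mul_right ?_ _) _
    rw [← pow_succ]
    exact pow_dvd_pow _ (Nat.succ_le_iff.mpr (not_le.mp (Finset.mem_filter.mp hv).2))
  rw [eq_neg_of_add_eq_zero_right hzero, dvd_neg, hlow,
    mul_dvd_mul_iff_left (pow_ne_zero s (Int.natCast_ne_zero.mpr hn)),
    IsUnit.dvd_mul_left (IsUnit.pow d isUnit_neg_one)] at hhigh
  exact_mod_cast hhigh

end Divisibility

/-! ### The additional symmetry for two levels and even strength -/

section TwoLevels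

variable {k s l p : ℕ}

/-- For two levels, the permutation of the runs that adds column `j₀` to all other columns. -/
def foldPerm (j₀ : Fin k) : Equiv.Perm (Fin k → Fin 2) :=
  Function.Involutive.toPerm (fun i j => if j = j₀ then i j else i j₀ + i j) fun i => by
    funext j
    by_cases h : j = j₀
    · simp [h]
    · simp only [h, if_true, if_false]
      generalize i j₀ = a
      generalize i j = b
      revert a b
      decide

lemma foldPerm_apply (j₀ : Fin k) (i : Fin k → Fin 2) (j : Fin k) :
    foldPerm j₀ i j = if j = j₀ then i j else i j₀ + i j := rfl

lemma foldPerm_comp_self (j₀ : Fin k) : foldPerm j₀ ∘ foldPerm j₀ = id :=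
  Function.Involutive.comp_self (Function.Involutive.toPerm_involutive _)

/-- The effect of `foldPerm j₀` on interactions: `j₀` is added to or removed from `u` if `u`
has an odd number of other columns. -/
def foldSet (j₀ : Fin k) (u : Finset (Fin k)) : Finset (Fin k) :=
  if Odd (u.erase j₀).card then (if j₀ ∈ u then u.erase j₀ else insert j₀ u) else u

/-- The sign `(-1) ^ (a - b)` of a pair of levels in `Fin 2`. -/
def levelSign (a b : Fin 2) : ℝ := if a = b then 1 else -1

lemma levelSign_mul_self (a b : Fin 2) : levelSign a b * levelSign a b = 1 := by
  unfold levelSign; split_ifs <;> norm_num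

lemma levelSign_add (a b c d : Fin 2) :
    levelSign (a + c) (b + d) = levelSign a b * levelSign c d := by
  have h : a + c = b + d ↔ (a = b ↔ c = d) := by
    revert a b c d
    decide
  by_cases hab : a = b <;> by_cases hcd : c = d <;> simp [levelSign, h, hab, hcd]

lemma interactionProj_two_apply (u : Finset (Fin k)) (i i' : Fin k → Fin 2) :
    interactionProj 2 u i i' = (2 : ℝ)⁻¹ ^ k * ∏ j ∈ u, levelSign (i j) (i' j) := by
  have h : ∀ j, (if j ∈ u then 1 - meanMatrix 2 else meanMatrix 2) (i j) (i' j) =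
      (2 : ℝ)⁻¹ * if j ∈ u then levelSign (i j) (i' j) else 1 := by
    intro j
    by_cases hj : j ∈ u <;> by_cases hij : i j = i' j <;>
      norm_num [hj, hij, meanMatrix, levelSign]
  rw [interactionProj, tensorMatrix_apply, Finset.prod_congr rfl fun j _ => h j,
    Finset.prod_mul_distrib, Fintype.prod_ite_mem]
  simp

lemma prod_levelSign_foldPerm {j₀ : Fin k} {v : Finset (Fin k)} (hv : j₀ ∉ v)
    (i i' : Fin k → Fin 2) :
    ∏ j ∈ v, levelSign (foldPerm j₀ i j) (foldPerm j₀ i' j) =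
      levelSign (i j₀) (i' j₀) ^ v.card * ∏ j ∈ v, levelSign (i j) (i' j) := by
  rw [← Finset.prod_const, ← Finset.prod_mul_distrib]
  refine Finset.prod_congr rfl fun j hj => ?_
  have hne : j ≠ j₀ := fun h => hv (h ▸ hj)
  rw [foldPerm_apply, foldPerm_apply, if_neg hne, if_neg hne, levelSign_add]

lemma interactionProj_foldPerm (j₀ : Fin k) (u : Finset (Fin k)) (i i' : Fin k → Fin 2) :
    interactionProj 2 u i i' =
      interactionProj 2 (foldSet j₀ u) (foldPerm j₀ i) (foldPerm j₀ i') := by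
  have hself : ∀ i : Fin k → Fin 2, foldPerm j₀ i j₀ = i j₀ := fun i => if_pos rfl
  have hs := levelSign_mul_self (i j₀) (i' j₀)
  simp only [interactionProj_two_apply]
  congr 1
  by_cases hu : j₀ ∈ u
  · have hv := Finset.notMem_erase j₀ u
    rw [← Finset.mul_prod_erase u _ hu]
    rcases Nat.even_or_odd' (u.erase j₀).card with ⟨c, hc | hc⟩
    · have hodd : ¬ Odd (u.erase j₀).card := by simp [hc]
      rw [foldSet, if_neg hodd, ← Finset.mul_prod_erase u _ hu, prod_levelSign_foldPerm hv,
        hself, hself, hc, pow_mul, pow_two, hs, one_pow, one_mul]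
    · have hodd : Odd (u.erase j₀).card := ⟨c, hc⟩
      rw [foldSet, if_pos hodd, if_pos hu, prod_levelSign_foldPerm hv, hc, pow_succ, pow_mul,
        pow_two, hs, one_pow, one_mul]
  · rcases Nat.even_or_odd' u.card with ⟨c, hc | hc⟩
    · have hodd : ¬ Odd (u.erase j₀).card := by simp [Finset.erase_eq_of_notMem hu, hc]
      rw [foldSet, if_neg hodd, prod_levelSign_foldPerm hu, hc, pow_mul, pow_two, hs, one_pow,
        one_mul]
    · have hodd : Odd (u.erase j₀).card := by simp [Finset.erase_eq_of_notMem hu, hc]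
      rw [foldSet, if_pos hodd, if_neg hu, Finset.prod_insert hu, prod_levelSign_foldPerm hu,
        hself, hself, ← mul_assoc, ← pow_succ', hc, show 2 * c + 1 + 1 = 2 * (c + 1) by ring,
        pow_mul, pow_two, hs, one_pow, one_mul]

/-- For even strength, `foldPerm` preserves feasibility, since `foldSet` only exchanges sizes
`2 m - 1` and `2 m`. -/
lemma comp_foldPerm_mem_feasibleJ (hs : Even s) (j₀ : Fin k) {x : (Fin k → Fin 2) → ℝ}
    (hx : x ∈ feasibleJ k 2 s l p) : x ∘ foldPerm j₀ ∈ feasibleJ k 2 s l p := by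
  refine comp_mem_feasibleJ two_ne_zero _ (foldSet j₀) (interactionProj_foldPerm j₀)
    (by simp [foldSet]) (fun u hu hus => ?_) hx
  unfold foldSet
  split_ifs with hodd hmem
  · exact ⟨Finset.card_pos.mp hodd.pos, (Finset.card_erase_le).trans hus⟩
  · rw [Finset.erase_eq_of_notMem hmem] at hodd
    refine ⟨Finset.insert_nonempty _ _, ?_⟩
    rw [Finset.card_insert_of_notMem hmem]
    have hne : u.card ≠ s := fun h => (Nat.not_even_iff_odd.mpr hodd) (h ▸ hs)
    omega
  · exact ⟨hu, hus⟩

/-- The folded set of columns may replace `u`, because `foldPerm j₀` is an involution that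
preserves feasibility. -/
lemma interactionProj_eq_zero_of_foldSet (hs : Even s) (j₀ : Fin k) {u : Finset (Fin k)}
    (h : ∀ x ∈ feasibleJ k 2 s l p, interactionProj 2 (foldSet j₀ u) *ᵥ x = 0)
    {x : (Fin k → Fin 2) → ℝ} (hx : x ∈ feasibleJ k 2 s l p) :
    interactionProj 2 u *ᵥ x = 0 := by
  have hx' := comp_foldPerm_mem_feasibleJ hs j₀ hx
  have := mulVec_comp_equiv (foldPerm j₀) (interactionProj_foldPerm j₀ u) (x ∘ foldPerm j₀)
  rw [Function.comp_assoc, foldPerm_comp_self, Function.comp_id, h _ hx'] at this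
  exact this

/-- For two levels and even strength, interactions of odd size `m` and of size `m + 1` vanish
simultaneously. -/
lemma mem_vanishingSizes_succ_iff (hs : Even s) {m : ℕ} (hm : Odd m) (hsm : s + 1 ≤ m)
    (hmk : m + 1 ≤ k) :
    m + 1 ∈ vanishingSizes k 2 s l p ↔ m ∈ vanishingSizes k 2 s l p := by
  rw [mem_vanishingSizes, mem_vanishingSizes]
  constructor
  · rintro ⟨-, h⟩
    refine ⟨⟨hsm, by omega⟩, fun x hx u hu => ?_⟩
    obtain ⟨j₀, hj₀⟩ : ∃ j₀, j₀ ∉ u := by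
      by_contra! hall
      have := Finset.card_eq_iff_eq_univ u |>.mpr (Finset.eq_univ_iff_forall.mpr hall)
      rw [Fintype.card_fin] at this
      omega
    refine interactionProj_eq_zero_of_foldSet hs j₀ (fun y hy => h y hy _ ?_) hx
    rw [foldSet, Finset.erase_eq_of_notMem hj₀, hu, if_pos hm, if_neg hj₀,
      Finset.card_insert_of_notMem hj₀, hu]
  · rintro ⟨-, h⟩
    refine ⟨⟨by omega, hmk⟩, fun x hx u hu => ?_⟩
    obtain ⟨j₀, hj₀⟩ : u.Nonempty := Finset.card_pos.mp (by omega)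
    have hc : (u.erase j₀).card = m := by rw [Finset.card_erase_of_mem hj₀, hu]; rfl
    refine interactionProj_eq_zero_of_foldSet hs j₀ (fun y hy => h y hy _ ?_) hx
    rw [foldSet, hc, if_pos hm, if_pos hj₀, hc]

end TwoLevels

/-! ### Dimension and description of the affine hull -/

section Main

variable {k n s l p : ℕ}

/-- Only the sizes up to `k` matter, since there are `k` columns. -/
lemma jVanishing_congr {A B : Set ℕ} (h : ∀ m ≤ k, m ∈ A ↔ m ∈ B) :
    jVanishing k n s l A = jVanishing k n s l B := by
  ext x
  refine and_congr_right fun _ => forall_congr' fun u => ?_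
  rw [h u.card (by simpa using Finset.card_le_univ u)]

lemma dvd_of_mem_vanishingSizes (hn : n ≠ 0) {x : (Fin k → Fin n) → ℝ}
    (hx : x ∈ feasibleJ k n s l p) {d : ℕ} (hd : 1 ≤ d)
    (h : s + d ∈ vanishingSizes k n s l p) : n ∣ l * (s + d - 1).choose (d - 1) := by
  obtain ⟨⟨-, hk⟩, hv⟩ := mem_vanishingSizes.mp h
  obtain ⟨u, -, hu⟩ := Finset.exists_superset_card_eq
    (s := (∅ : Finset (Fin k))) (n := s + d) (by simp) (by simpa using hk)
  exact dvd_of_interactionProj_mulVec_eq_zero hn hx hu hd (hv x hx u hu)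

lemma convDim_oaPolytope (hn : n ≠ 0) (hsk : s ≤ k) :
    (convDim (oaPolytope k n s l p) : ℤ) =
      (n : ℤ) ^ k - ∑ j ∈ Finset.range (s + 1), (k.choose j : ℤ) * ((n : ℤ) - 1) ^ j -
        ∑ j ∈ vanishingSizes k n s l p, (k.choose j : ℤ) * ((n : ℤ) - 1) ^ j := by
  rw [convDim, oaPolytope, affineSpan_convexHull, direction_affineSpan,
    feasible_eq_feasibleJ hn hsk, finrank_vectorSpan_feasibleJ hn hsk]

end Main

theorem mainTheorem1 (k n s l p : ℕ) (hn : 2 ≤ n) (hs : 1 ≤ s) (hsk : s ≤ k) (hl : 1 ≤ l)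
    (hp : 1 ≤ p) (hpl : p ≤ l)
    (x : (Fin k → Fin n) → ℝ) (hx : x ∈ feasibleJ k n s l p) :
    (∃ T : Finset ℕ, T ⊆ omegaSet k n s l ∧
      (convDim (oaPolytope k n s l p) : ℤ) =
        (n : ℤ) ^ k - ∑ j ∈ Finset.range (s + 1), (k.choose j : ℤ) * ((n : ℤ) - 1) ^ j
          - ∑ d ∈ T, (k.choose (s + d) : ℤ) * ((n : ℤ) - 1) ^ (s + d) ∧
      (affineSpan ℝ (feasibleJ k n s l p) : Set ((Fin k → Fin n) → ℝ)) =
        jVanishing k n s l {m | ∃ d ∈ T, m = s + d} ∧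
      (affineSpan ℝ (feasible k n s l p) : Set ((Fin k → Fin n) → ℝ)) =
        jVanishing k n s l {m | ∃ d ∈ T, m = s + d}) ∧
    (n = 2 → Even s →
      ∃ T : Finset ℕ, T ⊆ omegaEven k s l ∧
        (convDim (oaPolytope k n s l p) : ℤ) =
          2 ^ k - ∑ j ∈ Finset.range (s + 1), (k.choose j : ℤ)
            - ∑ d ∈ T, ((k.choose (s + d + 1) : ℤ) + (k.choose (s + d + 2) : ℤ)) ∧
        (affineSpan ℝ (feasibleJ k n s l p) : Set ((Fin k → Fin n) → ℝ)) =
          jVanishing k n s l {m | ∃ d ∈ T, m = s + d + 1 ∨ m = s + d + 2} ∧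
        (affineSpan ℝ (feasible k n s l p) : Set ((Fin k → Fin n) → ℝ)) =
          jVanishing k n s l {m | ∃ d ∈ T, m = s + d + 1 ∨ m = s + d + 2}) := by
  have hn0 : n ≠ 0 := by omega
  have hrange : ∀ m ∈ vanishingSizes k n s l p, s + 1 ≤ m ∧ m ≤ k := fun m hm =>
    (mem_vanishingSizes.mp hm).1
  refine ⟨?_, ?_⟩
  · have hB : (vanishingSizes k n s l p) =
        ({d ∈ Finset.Icc 1 (k - s) | s + d ∈ vanishingSizes k n s l p}).image (s + ·) := by
      ext m
      simp only [Finset.mem_image, Finset.mem_filter, Finset.mem_Icc]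
      constructor
      · intro hm
        obtain ⟨h1, h2⟩ := hrange m hm
        have hsm : s + (m - s) = m := by omega
        exact ⟨m - s, ⟨⟨by omega, by omega⟩, hsm.symm ▸ hm⟩, hsm⟩
      · rintro ⟨d, ⟨-, hd⟩, rfl⟩
        exact hd
    have haff : (affineSpan ℝ (feasibleJ k n s l p) : Set ((Fin k → Fin n) → ℝ)) =
        jVanishing k n s l {m | ∃ d ∈ ({d ∈ Finset.Icc 1 (k - s) |
          s + d ∈ vanishingSizes k n s l p} : Finset ℕ), m = s + d} := by
      rw [affineSpan_feasibleJ hn0 hx]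
      refine jVanishing_congr fun m _ => ?_
      conv_lhs => rw [hB]
      simp [eq_comm]
    refine ⟨_, fun d hd => ?_, ?_, haff, by rwa [feasible_eq_feasibleJ hn0 hsk]⟩
    · rw [Finset.mem_filter] at hd
      exact Finset.mem_filter.mpr ⟨hd.1,
        dvd_of_mem_vanishingSizes hn0 hx (Finset.mem_Icc.mp hd.1).1 hd.2⟩
    · rw [convDim_oaPolytope hn0 hsk]
      conv_lhs => rw [hB]
      rw [Finset.sum_image (by simp)]
  · rintro rfl hse
    set T : Finset ℕ := {d ∈ Finset.range (k - s) |
      Even d ∧ s + d + 1 ∈ vanishingSizes k 2 s l p} with hT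
    have hmem : ∀ m ≤ k, m ∈ vanishingSizes k 2 s l p ↔
        ∃ d ∈ T, m = s + d + 1 ∨ m = s + d + 2 := by
      intro m hmk
      constructor
      · intro hm
        obtain ⟨h1, -⟩ := hrange m hm
        rcases Nat.even_or_odd (m - s - 1) with hpar | hpar
        · have hsm : s + (m - s - 1) + 1 = m := by omega
          refine ⟨m - s - 1, ?_, Or.inl hsm.symm⟩
          rw [hT, Finset.mem_filter, Finset.mem_range, hsm]
          exact ⟨by omega, hpar, hm⟩
        · obtain ⟨c, hc⟩ := hpar
          have hsm : m = s + 2 * c + 2 := by omega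
          refine ⟨2 * c, ?_, Or.inr hsm⟩
          rw [hT, Finset.mem_filter, Finset.mem_range]
          refine ⟨by omega, even_two_mul c, ?_⟩
          subst hsm
          exact (mem_vanishingSizes_succ_iff hse
            ((hse.add (even_two_mul c)).add_one) (by omega) hmk).mp hm
      · rintro ⟨d, hd, hmd⟩
        rw [hT, Finset.mem_filter] at hd
        obtain ⟨-, hde, hdv⟩ := hd
        rcases hmd with rfl | rfl
        · exact hdv
        · exact (mem_vanishingSizes_succ_iff hse (hse.add hde).add_one (by omega) hmk).mpr hdv
    have haff : (affineSpan ℝ (feasibleJ k 2 s l p) : Set ((Fin k → Fin 2) → ℝ)) =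
        jVanishing k 2 s l {m | ∃ d ∈ T, m = s + d + 1 ∨ m = s + d + 2} := by
      rw [affineSpan_feasibleJ hn0 hx]
      exact jVanishing_congr hmem
    refine ⟨T, fun d hd => ?_, ?_, haff, by rwa [feasible_eq_feasibleJ hn0 hsk]⟩
    · rw [hT, Finset.mem_filter] at hd
      refine Finset.mem_filter.mpr ⟨hd.1, hd.2.1, ?_⟩
      have := dvd_of_mem_vanishingSizes hn0 hx (d := d + 1) (by omega) hd.2.2
      simpa using this
    · have hdisj : Disjoint (T.image (s + · + 1)) (T.image (s + · + 2)) := by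
        rw [Finset.disjoint_left]
        simp only [Finset.mem_image, hT, Finset.mem_filter]
        rintro _ ⟨d, ⟨-, ⟨a, ha⟩, -⟩, rfl⟩ ⟨d', ⟨-, ⟨b, hb⟩, -⟩, h⟩
        omega
      -- the size `k + 1`, which may occur among the `s + d + 2`, contributes `C(k, k + 1) = 0`
      have hsum : ∑ j ∈ vanishingSizes k 2 s l p, (k.choose j : ℤ) =
          ∑ j ∈ T.image (s + · + 1) ∪ T.image (s + · + 2), (k.choose j : ℤ) := by
        refine Finset.sum_subset (fun m hm => ?_) fun m hm hm' => ?_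
        · obtain ⟨d, hd, h⟩ := (hmem m (hrange m hm).2).mp hm
          simp only [Finset.mem_union, Finset.mem_image]
          exact h.imp (fun h => ⟨d, hd, h.symm⟩) (fun h => ⟨d, hd, h.symm⟩)
        · have hkm : k < m := by
            by_contra! hmk
            refine hm' ((hmem m hmk).mpr ?_)
            simp only [Finset.mem_union, Finset.mem_image] at hm
            rcases hm with ⟨d, hd, h⟩ | ⟨d, hd, h⟩
            · exact ⟨d, hd, Or.inl h.symm⟩
            · exact ⟨d, hd, Or.inr h.symm⟩
          rw [Nat.choose_eq_zero_of_lt hkm, Nat.cast_zero]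
      rw [Finset.sum_union hdisj, Finset.sum_image (by simp), Finset.sum_image (by simp),
        ← Finset.sum_add_distrib] at hsum
      rw [convDim_oaPolytope hn0 hsk, ← hsum]
      norm_num
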